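/- Let $H$ be a real or complex Hilbert space of finite dimension $n\ge 2$, let $\mathrm{Sym}(H)=\{T:H\to H \text{ linear},\ T=T^*\}$, and let $S^{1,0}(H)\subset \mathrm{Sym}(H)$ be the set of non-negative self-adjoint operators of rank at most one. For $1\le p<\infty$ let $\|T\|_p=\big(\sum_{k=1}^n\sigma_k^p\big)^{1/p}$, and let $\|T\|_\infty=\max_{1\le k\le n}\sigma_k$, where $\sigma_1,\dots,\sigma_n$ are the singular values of $T$ (Schatten norms). For $A\in\mathrm{Sym}(H)$ with eigenvalues $\lambda_1\ge\lambda_2\ge\cdots\ge\lambda_n$, listed with multiplicity, let $P_1$ be the orthogonal projection onto the eigenspace $\ker(A-\lambda_1 I)$ and put $$\pi(A)=(\lambda_1-\lambda_2)P_1 .$$ Then $\pi$ maps $\mathrm{Sym}(H)$ into $S^{1,0}(H)$, and: 1. for every $1\le p\le\infty$, $\pi$ is Lipschitz continuous from $(\mathrm{Sym}(H),\|\cdot\|_p)$ to $(S^{1,0}(H),\|\cdot\|_p)$ with Lipschitz constant at most $3+2^{1+\frac1p}$, that is, $\|\pi(A)-\pi(B)\|_p\le\big(3+2^{1+\frac1p}\big)\|A-B\|_p$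 for all $A,B\in\mathrm{Sym}(H)$ (with $\frac1p=0$ for $p=\infty$); 2. $\pi(A)=A$ for all $A\in S^{1,0}(H)$. -/

import Mathlib

open scoped ENNReal

/-- `Sym(H) = {T : H → H, T = T*}`: the self-adjoint operators on `H`. -/
abbrev SymOp (𝕜 H : Type*) [RCLike 𝕜] [NormedAddCommGroup H] [InnerProductSpace 𝕜 H] : Type _ :=
  {T : H →ₗ[𝕜] H // T.IsSymmetric}

/-- `S^{1,0}(H)`: the non-negative self-adjoint operators of rank at most one. -/
def psdRankLEOne (𝕜 H : Type*) [RCLike 𝕜] [NormedAddCommGroup H] [InnerProductSpace 𝕜 H] :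
    Set (H →ₗ[𝕜] H) :=
  {T | T.IsPositive ∧ T.rank ≤ 1}

section

variable {𝕜 H : Type*} [RCLike 𝕜] [NormedAddCommGroup H] [InnerProductSpace 𝕜 H]
  [FiniteDimensional 𝕜 H]

/-- The Schatten `p`-norm of an operator on the `n`-dimensional space `H`, with singular values
`σ_0, …, σ_{n-1}`: it is `max_k σ_k` for `p = ∞`, and `(∑_k σ_k ^ p) ^ (1 / p)` otherwise. -/
noncomputable def schattenNorm (p : ℝ≥0∞) (T : H →ₗ[𝕜] H) : ℝ :=
  if p = ∞ then ⨆ k : Fin (Module.finrank 𝕜 H), T.singularValues k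
  else (∑ k : Fin (Module.finrank 𝕜 H), T.singularValues k ^ p.toReal) ^ (1 / p.toReal)

/-- The `k`-th eigenvalue (`k` counted from `0`) of a self-adjoint operator, the eigenvalues being
listed with multiplicity in decreasing order. -/
noncomputable def SymOp.eig (A : SymOp 𝕜 H) (k : Fin (Module.finrank 𝕜 H)) : ℝ :=
  A.2.eigenvalues rfl k

/-- The map `π(A) = (λ₁ - λ₂) P₁`, where `λ₁ ≥ λ₂ ≥ … ≥ λ_n` are the eigenvalues of `A` with
multiplicity and `P₁` is the orthogonal projection onto the whole eigenspace of `λ₁`. -/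
noncomputable def gapMap (hn : 2 ≤ Module.finrank 𝕜 H) (A : SymOp 𝕜 H) : H →ₗ[𝕜] H :=
  ((A.eig ⟨0, by omega⟩ - A.eig ⟨1, by omega⟩ : ℝ) : 𝕜) •
    ((Module.End.eigenspace A.1 ((A.eig ⟨0, by omega⟩ : ℝ) : 𝕜)).starProjection : H →ₗ[𝕜] H)

end

/-!
The map `π` is Lipschitz already for the operator norm, with constant `2√3 ≤ 7/2`, and the rank of
`π(A) - π(B)` is at most two. An operator of rank at most two has at most two nonzero singular
values, so that its Schatten `p`-norm is at most `2 ^ (1 / p)` times its operator norm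
(`schattenNorm_le_of_finrank_range_le`), while every Schatten norm dominates the operator norm
(`norm_apply_le_schattenNorm`). As `2 ^ (1 / p) ≤ 2`, the constant `7/2 * 2 ^ (1 / p)` is at most
`3 + 2 * 2 ^ (1 / p)`. No triangle inequality for the Schatten norms is needed.

For the operator norm, let `δ = ‖A - B‖`, let `u` and `v` be unit top eigenvectors of `A` and `B`,
at an angle `θ`, and let `a` and `b` be the spectral gaps. Then `π(A) = a u u*` and `π(B) = b v v*`,
also when a gap vanishes (`gapMap_apply`). Weyl's inequality gives `|a - b| ≤ 2δ`, and the
Davis–Kahan argument (`LinearMap.IsSymmetric.gap_mul_norm_sub_le`) gives `a sin θ ≤ 2δ` and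
`b sin θ ≤ 2δ`. Splitting `(a u u* - b v v*) x` along `u` and its orthogonal complement, and `x` along
`v` and its orthogonal complement, gives the bound (`norm_sq_smul_sub_smul_le`).
-/

/-! ### Perturbation of eigenvalues and top eigenvectors -/

section

variable {𝕜 H : Type*} [RCLike 𝕜] [NormedAddCommGroup H] [InnerProductSpace 𝕜 H]
  [FiniteDimensional 𝕜 H]

theorem LinearMap.IsSymmetric.re_inner_apply_self_eq_sum {T : H →ₗ[𝕜] H} (hT : T.IsSymmetric)
    (x : H) :
    RCLike.re (inner 𝕜 x (T x)) =
      ∑ i, hT.eigenvalues rfl i * ‖inner 𝕜 (hT.eigenvectorBasis rfl i) x‖ ^ 2 := by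
  rw [← (hT.eigenvectorBasis rfl).sum_inner_mul_inner x (T x), map_sum]
  refine Finset.sum_congr rfl fun i _ => ?_
  have h := hT.eigenvectorBasis_apply_self_apply rfl x i
  rw [OrthonormalBasis.repr_apply_apply, OrthonormalBasis.repr_apply_apply] at h
  rw [h, mul_left_comm, ← inner_conj_symm x, RCLike.conj_mul, ← RCLike.ofReal_pow,
    ← RCLike.ofReal_mul, RCLike.ofReal_re]

theorem LinearMap.IsSymmetric.re_inner_apply_self_le {T : H →ₗ[𝕜] H} (hT : T.IsSymmetric)
    (k : Fin (Module.finrank 𝕜 H)) {x : H}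
    (hx : ∀ i < k, inner 𝕜 (hT.eigenvectorBasis rfl i) x = 0) :
    RCLike.re (inner 𝕜 x (T x)) ≤ hT.eigenvalues rfl k * ‖x‖ ^ 2 := by
  rw [hT.re_inner_apply_self_eq_sum, ← (hT.eigenvectorBasis rfl).sum_sq_norm_inner_right x,
    Finset.mul_sum]
  refine Finset.sum_le_sum fun i _ => ?_
  rcases lt_or_ge i k with h | h
  · simp [hx i h]
  · gcongr
    exact hT.eigenvalues_antitone rfl h

theorem LinearMap.IsSymmetric.le_re_inner_apply_self {T : H →ₗ[𝕜] H} (hT : T.IsSymmetric)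
    (k : Fin (Module.finrank 𝕜 H)) {x : H}
    (hx : ∀ i, k < i → inner 𝕜 (hT.eigenvectorBasis rfl i) x = 0) :
    hT.eigenvalues rfl k * ‖x‖ ^ 2 ≤ RCLike.re (inner 𝕜 x (T x)) := by
  rw [hT.re_inner_apply_self_eq_sum, ← (hT.eigenvectorBasis rfl).sum_sq_norm_inner_right x,
    Finset.mul_sum]
  refine Finset.sum_le_sum fun i _ => ?_
  rcases lt_or_ge k i with h | h
  · simp [hx i h]
  · gcongr
    exact hT.eigenvalues_antitone rfl h

/-- **Weyl's inequality**: the ordered eigenvalues are 1-Lipschitz for the operator norm. The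
`n - 1` linear conditions below have a common nonzero solution, on which the `k`-th eigenvalues of
`A` and `B` are compared through the quadratic forms. -/
theorem LinearMap.IsSymmetric.eigenvalues_le_add {A B : H →ₗ[𝕜] H} (hA : A.IsSymmetric)
    (hB : B.IsSymmetric) {δ : ℝ} (h : ∀ x, ‖(A - B) x‖ ≤ δ * ‖x‖)
    (k : Fin (Module.finrank 𝕜 H)) :
    hA.eigenvalues rfl k ≤ hB.eigenvalues rfl k + δ := by
  let L : H →ₗ[𝕜] ({i // i ≠ k} → 𝕜) := LinearMap.pi fun i =>
    innerₛₗ 𝕜 (if i.1 < k then hB.eigenvectorBasis rfl i else hA.eigenvectorBasis rfl i)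
  have hL : LinearMap.ker L ≠ ⊥ := by
    apply LinearMap.ker_ne_bot_of_finrank_lt
    have := k.2
    simp only [Module.finrank_fintype_fun_eq_card, ne_eq, Fintype.card_subtype_compl,
      Fintype.card_fin, Fintype.card_unique]
    omega
  obtain ⟨x, hx, hx0⟩ := Submodule.exists_mem_ne_zero_of_ne_bot hL
  have hx' (i : Fin (Module.finrank 𝕜 H)) (hi : i ≠ k) := congrFun (LinearMap.mem_ker.1 hx) ⟨i, hi⟩
  have h1 := hA.le_re_inner_apply_self k (x := x) fun i hi => by
    simpa [L, hi.not_gt] using hx' i hi.ne'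
  have h2 := hB.re_inner_apply_self_le k (x := x) fun i hi => by
    simpa [L, hi] using hx' i hi.ne
  have h3 : RCLike.re (inner 𝕜 x ((A - B) x)) ≤ ‖x‖ * (δ * ‖x‖) :=
    (re_inner_le_norm _ _).trans (by gcongr; exact h x)
  rw [LinearMap.sub_apply, inner_sub_right, map_sub] at h3
  have h4 : 0 < ‖x‖ ^ 2 := by positivity
  nlinarith

theorem LinearMap.IsSymmetric.abs_eigenvalues_sub_le {A B : H →ₗ[𝕜] H} (hA : A.IsSymmetric)
    (hB : B.IsSymmetric) {δ : ℝ} (h : ∀ x, ‖(A - B) x‖ ≤ δ * ‖x‖)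
    (k : Fin (Module.finrank 𝕜 H)) :
    |hA.eigenvalues rfl k - hB.eigenvalues rfl k| ≤ δ := by
  have h' (x : H) : ‖(B - A) x‖ ≤ δ * ‖x‖ := by
    rw [LinearMap.sub_apply, norm_sub_rev]
    exact h x
  have := hA.eigenvalues_le_add hB h k
  have := hB.eigenvalues_le_add hA h' k
  rw [abs_le]
  constructor <;> linarith

/-- **Davis–Kahan bound**: the spectral gap of `B` times the sine of the angle between the top
eigenvectors of `A` and `B` is at most twice the distance between `A` and `B`. -/
theorem LinearMap.IsSymmetric.gap_mul_norm_sub_le {A B : H →ₗ[𝕜] H} (hA : A.IsSymmetric)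
    (hB : B.IsSymmetric) {δ : ℝ} (h : ∀ x, ‖(A - B) x‖ ≤ δ * ‖x‖)
    {k l : Fin (Module.finrank 𝕜 H)} (hk : (k : ℕ) = 0) (hl : (l : ℕ) = 1) :
    (hB.eigenvalues rfl k - hB.eigenvalues rfl l) *
      ‖hA.eigenvectorBasis rfl k - inner 𝕜 (hB.eigenvectorBasis rfl k)
        (hA.eigenvectorBasis rfl k) • hB.eigenvectorBasis rfl k‖ ≤ 2 * δ := by
  set u := hA.eigenvectorBasis rfl k with hu
  set v := hB.eigenvectorBasis rfl k with hv
  set w := u - inner 𝕜 v u • v with hw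
  have hu1 : ‖u‖ = 1 := (hA.eigenvectorBasis rfl).norm_eq_one k
  have hv1 : ‖v‖ = 1 := (hB.eigenvectorBasis rfl).norm_eq_one k
  have hvw : inner 𝕜 v w = 0 := by
    rw [hw, inner_sub_right, inner_smul_right, inner_self_eq_norm_sq_to_K, hv1]
    simp
  have hwv : inner 𝕜 w v = 0 := inner_eq_zero_symm.1 hvw
  have huw : u = w + inner 𝕜 v u • v := by simp [hw]
  have hδ : 0 ≤ δ := by simpa [hu1] using (norm_nonneg _).trans (h u)
  -- `w` is orthogonal to `v`, so that the quadratic form of `B` at `w` is at most `μ₂ ‖w‖²`.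
  have hBw : RCLike.re (inner 𝕜 w (B w)) ≤ hB.eigenvalues rfl l * ‖w‖ ^ 2 := by
    refine hB.re_inner_apply_self_le l fun i hi => ?_
    obtain rfl : i = k := Fin.ext (by have := Fin.lt_def.1 hi; omega)
    exact hvw
  have hBu : inner 𝕜 w (B u) = inner 𝕜 w (B w) := by
    conv_lhs => rw [huw]
    rw [map_add, map_smul, hv, hB.apply_eigenvectorBasis, ← hv, inner_add_right,
      inner_smul_right, inner_smul_right, hwv]
    simp
  have hAu : RCLike.re (inner 𝕜 w (A u)) = hA.eigenvalues rfl k * ‖w‖ ^ 2 := by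
    have : inner 𝕜 w u = (‖w‖ : 𝕜) ^ 2 := by
      conv_lhs => rw [huw]
      rw [inner_add_right, inner_smul_right, hwv, inner_self_eq_norm_sq_to_K]
      simp
    rw [hu, hA.apply_eigenvectorBasis, ← hu, inner_smul_right, this, ← RCLike.ofReal_pow,
      ← RCLike.ofReal_mul, RCLike.ofReal_re]
  have h3 : RCLike.re (inner 𝕜 w ((A - B) u)) ≤ ‖w‖ * (δ * ‖u‖) :=
    (re_inner_le_norm _ _).trans (by gcongr; exact h u)
  rw [LinearMap.sub_apply, inner_sub_right, map_sub, hBu, hAu, hu1] at h3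
  have hw1 : ‖w‖ ≤ 1 := by
    have := norm_add_sq (𝕜 := 𝕜) w (inner 𝕜 v u • v)
    rw [← huw, inner_smul_right, hwv, hu1] at this
    simp only [mul_zero, map_zero, add_zero] at this
    nlinarith [sq_nonneg ‖inner 𝕜 v u • v‖]
  have h4 := (abs_le.1 (hA.abs_eigenvalues_sub_le hB h k)).1
  rcases (norm_nonneg w).eq_or_lt with h0 | h0
  · rw [← h0]
    linarith
  · have h5 : (hA.eigenvalues rfl k - hB.eigenvalues rfl l) * ‖w‖ ≤ δ :=
      le_of_mul_le_mul_left (by nlinarith) h0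
    nlinarith

end

/-! ### Differences of two rank-one operators -/

section

variable {𝕜 H : Type*} [RCLike 𝕜] [NormedAddCommGroup H] [InnerProductSpace 𝕜 H]

theorem norm_sq_eq_norm_inner_sq_add {u : H} (hu : ‖u‖ = 1) (x : H) :
    ‖x‖ ^ 2 = ‖inner 𝕜 u x‖ ^ 2 + ‖x - inner 𝕜 u x • u‖ ^ 2 := by
  have h0 : inner 𝕜 (inner 𝕜 u x • u) (x - inner 𝕜 u x • u) = 0 := by
    rw [inner_smul_left, inner_sub_right, inner_smul_right, inner_self_eq_norm_sq_to_K, hu]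
    simp
  have := norm_add_sq (𝕜 := 𝕜) (inner 𝕜 u x • u) (x - inner 𝕜 u x • u)
  rw [h0, add_sub_cancel, norm_smul, hu] at this
  simpa using this

/-- Both sides are the sine of the angle between the unit vectors `u` and `v`. -/
theorem norm_sub_inner_smul_comm {u v : H} (hu : ‖u‖ = 1) (hv : ‖v‖ = 1) :
    ‖u - inner 𝕜 v u • v‖ = ‖v - inner 𝕜 u v • u‖ := by
  have h1 := norm_sq_eq_norm_inner_sq_add (𝕜 := 𝕜) hv u
  have h2 := norm_sq_eq_norm_inner_sq_add (𝕜 := 𝕜) hu v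
  rw [norm_inner_symm, hu] at h1
  rw [hv] at h2
  exact (sq_eq_sq₀ (norm_nonneg _) (norm_nonneg _)).1 (by linarith)

/-- The operator `a u u* - b v v*` is bounded by `√3 d` when `|a - b|`, `a sin θ` and `b sin θ` are
at most `d`, where `θ` is the angle between the unit vectors `u` and `v`. -/
theorem norm_sq_smul_sub_smul_le {u v : H} (hu : ‖u‖ = 1) (hv : ‖v‖ = 1) {a b d : ℝ}
    (ha : 0 ≤ a) (hb : 0 ≤ b) (hab : |a - b| ≤ d) (had : a * ‖u - inner 𝕜 v u • v‖ ≤ d)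
    (hbd : b * ‖u - inner 𝕜 v u • v‖ ≤ d) (x : H) :
    ‖(a : 𝕜) • inner 𝕜 u x • u - (b : 𝕜) • inner 𝕜 v x • v‖ ^ 2 ≤ 3 * d ^ 2 * ‖x‖ ^ 2 := by
  set s := ‖u - inner 𝕜 v u • v‖ with hs
  set y := x - inner 𝕜 v x • v with hy
  set z := (a : 𝕜) • inner 𝕜 u x • u - (b : 𝕜) • inner 𝕜 v x • v with hz
  have hd : 0 ≤ d := (abs_nonneg _).trans hab
  have hvv : inner 𝕜 v v = (1 : 𝕜) := by simp [inner_self_eq_norm_sq_to_K, hv]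
  have huu : inner 𝕜 u u = (1 : 𝕜) := by simp [inner_self_eq_norm_sq_to_K, hu]
  -- The component along `u`, expanded over `v` and its orthogonal complement.
  have h1 : inner 𝕜 u z = ((a - b : ℝ) : 𝕜) * (inner 𝕜 u v * inner 𝕜 v x) +
      a * inner 𝕜 (u - inner 𝕜 v u • v) y := by
    simp only [hz, hy, inner_sub_left, inner_sub_right, inner_smul_left, inner_smul_right,
      inner_conj_symm, huu, hvv]
    push_cast
    ring
  have h2 : z - inner 𝕜 u z • u = -((b : 𝕜) * inner 𝕜 v x) • (v - inner 𝕜 u v • u) := by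
    simp only [hz, inner_sub_right, inner_smul_right, huu]
    module
  have h3 : ‖inner 𝕜 u z‖ ≤ d * (‖inner 𝕜 v x‖ + ‖y‖) := by
    rw [h1]
    refine (norm_add_le _ _).trans ?_
    rw [norm_mul, norm_mul, norm_mul, RCLike.norm_ofReal, RCLike.norm_ofReal, abs_of_nonneg ha,
      mul_add]
    have huv : ‖inner 𝕜 u v‖ ≤ 1 := by simpa [hu, hv] using norm_inner_le_norm (𝕜 := 𝕜) u v
    refine add_le_add ?_ ?_
    · calc |a - b| * (‖inner 𝕜 u v‖ * ‖inner 𝕜 v x‖) ≤ d * (1 * ‖inner 𝕜 v x‖) := by gcongr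
        _ = _ := by rw [one_mul]
    · calc a * ‖inner 𝕜 (u - inner 𝕜 v u • v) y‖ ≤ a * (s * ‖y‖) := by
            gcongr
            exact norm_inner_le_norm _ _
        _ = a * s * ‖y‖ := by ring
        _ ≤ d * ‖y‖ := by gcongr
  have h4 : ‖z - inner 𝕜 u z • u‖ ≤ d * ‖inner 𝕜 v x‖ := by
    rw [h2, norm_smul, norm_neg, norm_mul, RCLike.norm_ofReal, abs_of_nonneg hb,
      ← norm_sub_inner_smul_comm hu hv, ← hs, mul_right_comm]
    gcongr
  rw [norm_sq_eq_norm_inner_sq_add (𝕜 := 𝕜) hu z, norm_sq_eq_norm_inner_sq_add (𝕜 := 𝕜) hv x, ← hy]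
  calc ‖inner 𝕜 u z‖ ^ 2 + ‖z - inner 𝕜 u z • u‖ ^ 2
      ≤ (d * (‖inner 𝕜 v x‖ + ‖y‖)) ^ 2 + (d * ‖inner 𝕜 v x‖) ^ 2 := by gcongr
    _ ≤ 3 * d ^ 2 * (‖inner 𝕜 v x‖ ^ 2 + ‖y‖ ^ 2) := by
      nlinarith [mul_nonneg (sq_nonneg d) (add_nonneg (sq_nonneg (‖inner 𝕜 v x‖ - ‖y‖))
        (sq_nonneg ‖y‖))]

end

/-! ### Schatten norms and the operator norm -/

section

variable {𝕜 H : Type*} [RCLike 𝕜] [NormedAddCommGroup H] [InnerProductSpace 𝕜 H]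
  [FiniteDimensional 𝕜 H]

theorem LinearMap.norm_apply_le_singularValues_zero (T : H →ₗ[𝕜] H) (x : H) :
    ‖T x‖ ≤ T.singularValues 0 * ‖x‖ := by
  rcases (Module.finrank 𝕜 H).eq_zero_or_pos with h | h
  · have := Module.finrank_zero_iff.1 h
    simp [Subsingleton.elim x 0]
  · have h1 := T.isSymmetric_adjoint_comp_self.re_inner_apply_self_le ⟨0, h⟩ (x := x)
      fun i hi => absurd (Fin.lt_def.1 hi) (Nat.not_lt_zero _)
    rw [← T.sq_singularValues_of_lt rfl h, LinearMap.comp_apply, LinearMap.adjoint_inner_right,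
      inner_self_eq_norm_sq, ← mul_pow] at h1
    exact le_of_sq_le_sq h1 (mul_nonneg (T.singularValues_nonneg 0) (norm_nonneg x))

theorem LinearMap.singularValues_le_of_forall_norm_le {T : H →ₗ[𝕜] H} {M : ℝ} (hM : 0 ≤ M)
    (h : ∀ x, ‖T x‖ ≤ M * ‖x‖) (k : ℕ) : T.singularValues k ≤ M := by
  rcases le_or_gt (Module.finrank 𝕜 H) k with hk | hk
  · rwa [T.singularValues_of_finrank_le hk]
  · obtain ⟨x, hx, hx0⟩ :=
      (T.hasEigenvalue_adjoint_comp_self_sq_singularValues hk).exists_hasEigenvector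
    have h1 := inner_product_apply_eigenvector (𝕜 := 𝕜) (Module.End.mem_eigenspace_iff.1 hx)
    rw [LinearMap.comp_apply, LinearMap.adjoint_inner_right, inner_self_eq_norm_sq_to_K] at h1
    have h2 : ‖T x‖ ^ 2 = (T.singularValues k * ‖x‖) ^ 2 := by
      rw [mul_pow]
      exact_mod_cast h1
    have h3 := (sq_eq_sq₀ (norm_nonneg _)
      (mul_nonneg (T.singularValues_nonneg k) (norm_nonneg x))).1 h2
    exact le_of_mul_le_mul_right (h3 ▸ h x) (norm_pos_iff.2 hx0)

theorem sum_singularValues_rpow_nonneg (p : ℝ) (T : H →ₗ[𝕜] H) :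
    0 ≤ ∑ k : Fin (Module.finrank 𝕜 H), T.singularValues k ^ p :=
  Finset.sum_nonneg fun k _ => Real.rpow_nonneg (T.singularValues_nonneg k) _

theorem schattenNorm_nonneg (p : ℝ≥0∞) (T : H →ₗ[𝕜] H) : 0 ≤ schattenNorm p T := by
  unfold schattenNorm
  split_ifs
  · exact Real.iSup_nonneg fun k => T.singularValues_nonneg k
  · exact Real.rpow_nonneg (sum_singularValues_rpow_nonneg _ T) _

theorem singularValues_zero_le_schattenNorm {p : ℝ≥0∞} (hp : 1 ≤ p) (T : H →ₗ[𝕜] H) :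
    T.singularValues 0 ≤ schattenNorm p T := by
  rcases (Module.finrank 𝕜 H).eq_zero_or_pos with h | h
  · rw [T.singularValues_of_finrank_le h.le]
    exact schattenNorm_nonneg p T
  unfold schattenNorm
  split_ifs with hp'
  · exact le_ciSup (f := fun k : Fin (Module.finrank 𝕜 H) => T.singularValues k)
      (Set.finite_range _).bddAbove ⟨0, h⟩
  · have hp0 : 0 < p.toReal := ENNReal.toReal_pos (zero_lt_one.trans_le hp).ne' hp'
    rw [one_div, Real.le_rpow_inv_iff_of_pos (T.singularValues_nonneg 0)
      (sum_singularValues_rpow_nonneg _ T) hp0]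
    exact Finset.single_le_sum
      (f := fun k : Fin (Module.finrank 𝕜 H) => T.singularValues k ^ p.toReal)
      (fun k _ => Real.rpow_nonneg (T.singularValues_nonneg k) _) (Finset.mem_univ ⟨0, h⟩)

theorem norm_apply_le_schattenNorm {p : ℝ≥0∞} (hp : 1 ≤ p) (T : H →ₗ[𝕜] H) (x : H) :
    ‖T x‖ ≤ schattenNorm p T * ‖x‖ :=
  (T.norm_apply_le_singularValues_zero x).trans
    (by gcongr; exact singularValues_zero_le_schattenNorm hp T)

/-- An operator of rank at most `r` has at most `r` nonzero singular values, whence its Schatten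
`p`-norm is at most `r ^ (1 / p)` times its operator norm. -/
theorem schattenNorm_le_of_finrank_range_le {p : ℝ≥0∞} (hp : 1 ≤ p) {T : H →ₗ[𝕜] H} {M : ℝ}
    (hM : 0 ≤ M) (h : ∀ x, ‖T x‖ ≤ M * ‖x‖) {r : ℕ}
    (hr : Module.finrank 𝕜 (LinearMap.range T) ≤ r) :
    schattenNorm p T ≤ (r : ℝ) ^ (1 / p).toReal * M := by
  have hle (k : ℕ) := LinearMap.singularValues_le_of_forall_norm_le hM h k
  unfold schattenNorm
  split_ifs with hp'
  · subst hp'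
    simpa using Real.iSup_le (fun k : Fin (Module.finrank 𝕜 H) => hle k) hM
  · have hp0 : 0 < p.toReal := ENNReal.toReal_pos (zero_lt_one.trans_le hp).ne' hp'
    have hsum : ∑ k : Fin (Module.finrank 𝕜 H), T.singularValues k ^ p.toReal ≤
        r * M ^ p.toReal := by
      rw [Fin.sum_univ_eq_sum_range (fun k => T.singularValues k ^ p.toReal)]
      calc ∑ k ∈ Finset.range (Module.finrank 𝕜 H), T.singularValues k ^ p.toReal
          ≤ ∑ k ∈ Finset.range r, T.singularValues k ^ p.toReal := by
            rw [← Finset.sum_filter_of_ne (p := (· < r)) fun k _ hk => ?_]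
            · exact Finset.sum_le_sum_of_subset_of_nonneg (fun k hk => by
                simpa using (Finset.mem_filter.1 hk).2) fun k _ _ =>
                  Real.rpow_nonneg (T.singularValues_nonneg k) _
            · by_contra! hkr
              rw [T.singularValues_eq_zero_iff_le_finrank_range.2 (hr.trans hkr),
                Real.zero_rpow hp0.ne'] at hk
              exact hk rfl
        _ ≤ ∑ k ∈ Finset.range r, M ^ p.toReal := by
            refine Finset.sum_le_sum fun k _ => ?_
            have := T.singularValues_nonneg k
            gcongr
            exact hle k
        _ = r * M ^ p.toReal := by simp
    calc (∑ k : Fin (Module.finrank 𝕜 H), T.singularValues k ^ p.toReal) ^ (1 / p.toReal)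
        ≤ (r * M ^ p.toReal) ^ (1 / p.toReal) := by
          exact Real.rpow_le_rpow (sum_singularValues_rpow_nonneg _ T) hsum (by positivity)
      _ = (r : ℝ) ^ (1 / p).toReal * M := by
          rw [Real.mul_rpow (by positivity) (by positivity), ← Real.rpow_mul hM,
            mul_one_div_cancel hp0.ne', Real.rpow_one, ENNReal.toReal_div, ENNReal.toReal_one]

/-! ### The map `π` -/

theorem SymOp.eig_antitone (A : SymOp 𝕜 H) : Antitone A.eig :=
  A.2.eigenvalues_antitone rfl

/-- The map `π` in terms of one top eigenvector. If `λ₁ = λ₂` then both sides vanish, whatever the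
dimension of the top eigenspace. -/
theorem gapMap_apply (hn : 2 ≤ Module.finrank 𝕜 H) (A : SymOp 𝕜 H) (x : H) :
    gapMap hn A x = ((A.eig ⟨0, by omega⟩ - A.eig ⟨1, by omega⟩ : ℝ) : 𝕜) •
      inner 𝕜 (A.2.eigenvectorBasis rfl ⟨0, by omega⟩) x •
        A.2.eigenvectorBasis rfl ⟨0, by omega⟩ := by
  set u := A.2.eigenvectorBasis rfl ⟨0, by omega⟩ with hu
  rcases eq_or_ne (A.eig ⟨0, by omega⟩) (A.eig ⟨1, by omega⟩) with h | h
  · simp [gapMap, h]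
  have hu1 : ‖u‖ = 1 := (A.2.eigenvectorBasis rfl).norm_eq_one _
  have hspan : Module.End.eigenspace A.1 ((A.eig ⟨0, by omega⟩ : ℝ) : 𝕜) =
      Submodule.span 𝕜 {u} := by
    apply le_antisymm
    · intro y hy
      rw [Module.End.mem_eigenspace_iff] at hy
      -- Coefficients of `y` along the other eigenvectors vanish, the eigenvalues being distinct.
      have hi (i) (hi : i ≠ ⟨0, by omega⟩) : inner 𝕜 (A.2.eigenvectorBasis rfl i) y = 0 := by
        have h1 := A.2.eigenvectorBasis_apply_self_apply rfl y i
        rw [hy, map_smul, PiLp.smul_apply, smul_eq_mul, OrthonormalBasis.repr_apply_apply] at h1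
        have h2 : A.eig i ≤ A.eig ⟨1, by omega⟩ := A.eig_antitone <| Fin.le_def.2 <|
          Nat.one_le_iff_ne_zero.2 fun h0 => hi (Fin.ext h0)
        have h3 := A.eig_antitone (Fin.le_def.2 zero_le_one :
          (⟨0, by omega⟩ : Fin (Module.finrank 𝕜 H)) ≤ ⟨1, by omega⟩)
        by_contra hne
        have h4 : A.eig ⟨0, by omega⟩ = A.eig i := by
          exact_mod_cast mul_right_cancel₀ hne h1
        exact h (le_antisymm (h4 ▸ h2) h3)
      rw [Submodule.mem_span_singleton]
      refine ⟨inner 𝕜 u y, ?_⟩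
      conv_rhs => rw [← (A.2.eigenvectorBasis rfl).sum_repr' y, Finset.sum_eq_single ⟨0, by omega⟩
        (fun i _ h0 => by rw [hi i h0, zero_smul]) (by simp)]
    · rw [Submodule.span_singleton_le_iff_mem, Module.End.mem_eigenspace_iff]
      exact A.2.apply_eigenvectorBasis rfl _
  simp only [gapMap, LinearMap.smul_apply, ContinuousLinearMap.coe_coe]
  congr 1
  simp only [hspan]
  exact Submodule.starProjection_unit_singleton 𝕜 hu1 x

theorem SymOp.gap_nonneg (hn : 2 ≤ Module.finrank 𝕜 H) (A : SymOp 𝕜 H) :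
    0 ≤ A.eig ⟨0, by omega⟩ - A.eig ⟨1, by omega⟩ :=
  sub_nonneg.2 (A.eig_antitone (Fin.le_def.2 zero_le_one))

theorem range_gapMap_le (hn : 2 ≤ Module.finrank 𝕜 H) (A : SymOp 𝕜 H) :
    LinearMap.range (gapMap hn A) ≤
      Submodule.span 𝕜 {A.2.eigenvectorBasis rfl ⟨0, by omega⟩} := by
  rintro _ ⟨x, rfl⟩
  rw [gapMap_apply, smul_smul]
  exact Submodule.smul_mem _ _ (Submodule.mem_span_singleton_self _)

theorem gapMap_mem_psdRankLEOne (hn : 2 ≤ Module.finrank 𝕜 H) (A : SymOp 𝕜 H) :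
    gapMap hn A ∈ psdRankLEOne 𝕜 H := by
  refine ⟨⟨fun x y => ?_, fun x => ?_⟩, ?_⟩
  · simp only [gapMap_apply, inner_smul_left, inner_smul_right, inner_conj_symm, RCLike.conj_ofReal]
    ring
  · rw [gapMap_apply, inner_smul_left, inner_smul_left, RCLike.conj_ofReal, RCLike.conj_mul,
      ← RCLike.ofReal_pow, ← RCLike.ofReal_mul, RCLike.ofReal_re]
    exact mul_nonneg (A.gap_nonneg hn) (sq_nonneg _)
  · exact (Submodule.rank_mono (range_gapMap_le hn A)).trans ((rank_span_le _).trans (by simp))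

theorem finrank_range_gapMap_sub_le (hn : 2 ≤ Module.finrank 𝕜 H) (A B : SymOp 𝕜 H) :
    Module.finrank 𝕜 (LinearMap.range (gapMap hn A - gapMap hn B)) ≤ 2 := by
  have hle : LinearMap.range (gapMap hn A - gapMap hn B) ≤
      Submodule.span 𝕜 {A.2.eigenvectorBasis rfl ⟨0, by omega⟩} ⊔
        Submodule.span 𝕜 {B.2.eigenvectorBasis rfl ⟨0, by omega⟩} := by
    rintro _ ⟨x, rfl⟩
    exact Submodule.sub_mem _
      (Submodule.mem_sup_left (range_gapMap_le hn A (LinearMap.mem_range_self _ x)))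
      (Submodule.mem_sup_right (range_gapMap_le hn B (LinearMap.mem_range_self _ x)))
  refine (Submodule.finrank_mono hle).trans ((Submodule.finrank_add_le_finrank_add_finrank _ _).trans
    (add_le_add (b := 1) (d := 1) ?_ ?_)) <;>
  exact (finrank_span_le_card _).trans (by simp)

/-- The operator norm estimate `‖π(A) - π(B)‖ ≤ 7/2 ‖A - B‖`. -/
theorem norm_gapMap_sub_apply_le (hn : 2 ≤ Module.finrank 𝕜 H) {A B : SymOp 𝕜 H} {δ : ℝ}
    (hδ : 0 ≤ δ) (h : ∀ x, ‖(A.1 - B.1) x‖ ≤ δ * ‖x‖) (x : H) :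
    ‖(gapMap hn A - gapMap hn B) x‖ ≤ 7 / 2 * δ * ‖x‖ := by
  have h' (x : H) : ‖(B.1 - A.1) x‖ ≤ δ * ‖x‖ := by
    rw [LinearMap.sub_apply, norm_sub_rev]
    exact h x
  have hu := (A.2.eigenvectorBasis rfl).norm_eq_one ⟨0, by omega⟩
  have hv := (B.2.eigenvectorBasis rfl).norm_eq_one ⟨0, by omega⟩
  have hA := B.2.gap_mul_norm_sub_le A.2 h' (k := ⟨0, by omega⟩) (l := ⟨1, by omega⟩) rfl rfl
  have hB := A.2.gap_mul_norm_sub_le B.2 h (k := ⟨0, by omega⟩) (l := ⟨1, by omega⟩) rfl rfl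
  rw [← norm_sub_inner_smul_comm hu hv] at hA
  have h0 := abs_le.1 (A.2.abs_eigenvalues_sub_le B.2 h ⟨0, by omega⟩)
  have h1 := abs_le.1 (A.2.abs_eigenvalues_sub_le B.2 h ⟨1, by omega⟩)
  have hAB : |(A.eig ⟨0, by omega⟩ - A.eig ⟨1, by omega⟩) -
      (B.eig ⟨0, by omega⟩ - B.eig ⟨1, by omega⟩)| ≤ 2 * δ := by
    unfold SymOp.eig
    rw [abs_le]
    constructor <;> linarith
  have key := norm_sq_smul_sub_smul_le hu hv (A.gap_nonneg hn) (B.gap_nonneg hn) hAB hA hB x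
  rw [LinearMap.sub_apply, gapMap_apply, gapMap_apply]
  refine le_of_sq_le_sq (key.trans ?_) (by positivity)
  nlinarith [mul_nonneg (sq_nonneg δ) (sq_nonneg ‖x‖)]

theorem schattenNorm_gapMap_sub_le (hn : 2 ≤ Module.finrank 𝕜 H) {p : ℝ≥0∞} (hp : 1 ≤ p)
    (A B : SymOp 𝕜 H) :
    schattenNorm p (gapMap hn A - gapMap hn B) ≤
      (3 + (2 : ℝ) ^ (1 + (1 / p).toReal)) * schattenNorm p (A.1 - B.1) := by
  have hδ := schattenNorm_nonneg p (A.1 - B.1)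
  have h1 := schattenNorm_le_of_finrank_range_le hp (by positivity)
    (norm_gapMap_sub_apply_le hn hδ (norm_apply_le_schattenNorm hp (A.1 - B.1)))
    (finrank_range_gapMap_sub_le hn A B)
  refine h1.trans ?_
  have hp1 : (1 / p).toReal ≤ 1 := by
    rw [one_div]
    exact ENNReal.toReal_le_of_le_ofReal zero_le_one (by simpa using hp)
  have h2 : (2 : ℝ) ^ (1 / p).toReal ≤ 2 := by
    simpa using Real.rpow_le_rpow_of_exponent_le one_le_two hp1
  rw [Real.rpow_add two_pos, Real.rpow_one, ← mul_assoc, Nat.cast_ofNat]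
  gcongr
  linarith

theorem gapMap_eq_self (hn : 2 ≤ Module.finrank 𝕜 H) (A : SymOp 𝕜 H)
    (hA : A.1 ∈ psdRankLEOne 𝕜 H) : gapMap hn A = A.1 := by
  have hnonneg (i) : 0 ≤ A.eig i := hA.1.nonneg_eigenvalues rfl i
  -- A nonzero second eigenvalue would put two orthonormal eigenvectors into the range.
  have h1 : A.eig ⟨1, by omega⟩ = 0 := by
    by_contra hne
    have h0 : A.eig ⟨0, by omega⟩ ≠ 0 := fun h0 => hne <| le_antisymm
      (h0 ▸ A.eig_antitone (Fin.le_def.2 zero_le_one)) (hnonneg _)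
    have hmem (i) (hi : A.eig i ≠ 0) : A.2.eigenvectorBasis rfl i ∈ LinearMap.range A.1 := by
      refine ⟨((A.eig i : 𝕜))⁻¹ • A.2.eigenvectorBasis rfl i, ?_⟩
      rw [map_smul, A.2.apply_eigenvectorBasis]
      exact inv_smul_smul₀ (RCLike.ofReal_ne_zero.2 hi) _
    let f : Fin 2 → Fin (Module.finrank 𝕜 H) := Fin.castLE hn
    have hf (j : Fin 2) : A.2.eigenvectorBasis rfl (f j) ∈ LinearMap.range A.1 := by
      refine hmem _ ?_
      fin_cases j
      exacts [h0, hne]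
    have hli : LinearIndependent 𝕜
        fun j => (⟨A.2.eigenvectorBasis rfl (f j), hf j⟩ : LinearMap.range A.1) :=
      LinearIndependent.of_comp (LinearMap.range A.1).subtype
        ((A.2.eigenvectorBasis rfl).orthonormal.linearIndependent.comp f
          (Fin.castLE_injective hn))
    have h2 : Module.finrank 𝕜 (LinearMap.range A.1) ≤ 1 := Module.finrank_le_of_rank_le (by
      simpa using hA.2)
    have h3 := hli.fintype_card_le_finrank
    rw [Fintype.card_fin] at h3
    omega
  refine (A.2.eigenvectorBasis rfl).toBasis.ext fun i => ?_
  rw [OrthonormalBasis.coe_toBasis, gapMap_apply, A.2.apply_eigenvectorBasis, h1, sub_zero]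
  rcases eq_or_ne i ⟨0, by omega⟩ with rfl | hi
  · rw [inner_self_eq_norm_sq_to_K, OrthonormalBasis.norm_eq_one]
    simp [SymOp.eig]
  · have h2 : A.eig i = 0 := le_antisymm (h1 ▸ A.eig_antitone (Fin.le_def.2 <|
      Nat.one_le_iff_ne_zero.2 fun h0 => hi (Fin.ext h0))) (hnonneg i)
    rw [(A.2.eigenvectorBasis rfl).orthonormal.2 hi.symm]
    change _ = ((A.eig i : ℝ) : 𝕜) • _
    simp [h2]

end

theorem lemma3p3 {𝕜 H : Type*} [RCLike 𝕜] [NormedAddCommGroup H] [InnerProductSpace 𝕜 H]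
    [FiniteDimensional 𝕜 H] (hn : 2 ≤ Module.finrank 𝕜 H) :
    (∀ A : SymOp 𝕜 H, gapMap hn A ∈ psdRankLEOne 𝕜 H) ∧
    (∀ p : ℝ≥0∞, 1 ≤ p → ∀ A B : SymOp 𝕜 H,
      schattenNorm p (gapMap hn A - gapMap hn B) ≤
        (3 + (2 : ℝ) ^ (1 + (1 / p).toReal)) * schattenNorm p (A.1 - B.1)) ∧
    (∀ A : SymOp 𝕜 H, A.1 ∈ psdRankLEOne 𝕜 H → gapMap hn A = A.1) := by
  exact ⟨gapMap_mem_psdRankLEOne hn, fun p hp A B => schattenNorm_gapMap_sub_le hn hp A B,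
    gapMap_eq_self hn⟩
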